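/- Fix $T\ge 0$ and let $\Omega=R^+[0,T]$ be the set of all right-continuous functions $\omega:[0,T]\to[0,\infty)$. For $t\in[0,T]$ let $\mathcal F^\circ_t$ be the $\sigma$-algebra on $\Omega$ generated by the evaluations $\omega\mapsto\omega(s)$, $s\in[0,t]$, and let $\mathcal F_t$ be its universal completion (the sets that belong to the completion of $\mathcal F^\circ_t$ with respect to every probability measure on $\mathcal F^\circ_t$). A simple trading strategy $G$ consists of an initial capital $c\in\mathbb R$, an increasing sequence $\tau_1\le\tau_2\le\cdots$ of stopping times $\tau_n:\Omega\to[0,T]\cup\{\infty\}$ with respect to $(\mathcal F_t)$ such that for every $\omega\in\Omega$ only finitely many of the $\tau_n(\omega)$ are finite, and, for each $n$, a bounded $\mathcal F_{\tau_n}$-measurable function $h_n:\Omega\to\mathbb R$. Its capital process is $$\mathcal K^G_t(\omega)=c+\sum_{n=1}^\infty h_n(\omega)\bigl(\omega(\tau_{n+1}(\omega)\wedge t)-\omega(\tau_n(\omega)\wedge t)\bigr),\qquad t\in[0,T].$$ A positive capital process is a family of $\mathcal F_t$-measurable functions $S_t:\Omega\to[0,\infty]$, $t\in[0,T]$, of the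 form $S_t(\omega)=\sum_{m=1}^\infty\mathcal K^{G_m}_t(\omega)$, where the $G_m$ are simple trading strategies with $\mathcal K^{G_m}_t(\omega)\ge0$ for all $t\in[0,T]$ and $\omega\in\Omega$ and with initial capitals $c_m$ such that $\sum_m c_m<\infty$. A set $E\subseteq\Omega$ is null if there is a positive capital process $S$ with $S_0=1$ and $S_T(\omega)=\infty$ for all $\omega\in E$; a property of $\omega\in\Omega$ holds almost surely (in the game-theoretic sense) if the set of $\omega\in\Omega$ where it fails is null. Corollary. Almost surely, the price path $\omega\in R^+[0,T]$ is càdlàg, that is, it is right-continuous and has a finite left limit at every point of $(0,T]$. -/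

import Mathlib

open MeasureTheory Set Filter Topology
open scoped NNReal ENNReal

namespace RightContinuousMarket

/-- The time interval `[0, T]`. -/
abbrev TimeInterval (T : ℝ≥0) : Type := Set.Icc (0 : ℝ) (T : ℝ)

/-- The initial time `0`, as a point of `[0, T]`. -/
def initialTime (T : ℝ≥0) : TimeInterval T := ⟨0, le_refl _, T.coe_nonneg⟩

/-- The final time `T`, as a point of `[0, T]`. -/
def finalTime (T : ℝ≥0) : TimeInterval T := ⟨(T : ℝ), T.coe_nonneg, le_refl _⟩

/-- The sample space `R⁺[0, T]` of all positive (that is, `≥ 0`) right-continuous functions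
`ω : [0, T] → ℝ`. -/
structure PricePath (T : ℝ≥0) where
  /-- The price at each time. -/
  price : TimeInterval T → ℝ
  nonneg : ∀ t, 0 ≤ price t
  rightContinuous : ∀ t, ContinuousWithinAt price (Set.Ici t) t

/-- A function on `[0, T]` is càdlàg if it is right-continuous at each point and has a (finite)
left limit at each point. (At the point `0` the filter `𝓝[<] t` is trivial, so that nothing is
required of the left limit there.) -/
def IsCadlag {T : ℝ≥0} (f : TimeInterval T → ℝ) : Prop :=
  (∀ t, ContinuousWithinAt f (Set.Ici t) t) ∧ ∀ t, ∃ l : ℝ, Tendsto f (𝓝[<] t) (𝓝 l)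

/-- The universal completion of a σ-algebra `m`: the sets that belong to the completion of `m`
with respect to each probability measure on `m`. -/
@[reducible]
def universalCompletion {α : Type*} (m : MeasurableSpace α) : MeasurableSpace α where
  MeasurableSet' s := ∀ μ : Measure[m] α, IsProbabilityMeasure μ → NullMeasurableSet s μ
  measurableSet_empty := fun _ _ => nullMeasurableSet_empty
  measurableSet_compl := fun _ hs μ hμ => (hs μ hμ).compl
  measurableSet_iUnion := fun _ hs μ hμ => NullMeasurableSet.iUnion fun i => hs i μ hμ

theorem universalCompletion_mono {α : Type*} {m₁ m₂ : MeasurableSpace α} (h : m₁ ≤ m₂) :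
    universalCompletion m₁ ≤ universalCompletion m₂ := by
  intro s hs μ hμ
  have hs' := hs (μ.trim h) ⟨by rw [trim_measurableSet_eq h MeasurableSet.univ]; exact hμ.measure_univ⟩
  obtain ⟨t, ht, hst⟩ := hs'
  exact ⟨t, h t ht, ae_eq_of_ae_eq_trim hst⟩

/-- The σ-algebra `𝓕°_t` generated by the evaluations `ω ↦ ω(s)`, `s ∈ [0, t]`. -/
@[reducible]
def rawSigmaAlgebra (T : ℝ≥0) (t : TimeInterval T) : MeasurableSpace (PricePath T) :=
  ⨆ s : TimeInterval T, ⨆ _ : s ≤ t,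
    MeasurableSpace.comap (fun ω : PricePath T => ω.price s) (borel ℝ)

theorem rawSigmaAlgebra_mono (T : ℝ≥0) : Monotone (rawSigmaAlgebra T) := fun _ _ h =>
  iSup_mono fun _ => iSup_le fun hs => le_iSup_of_le (hs.trans h) le_rfl

/-- The filtration `(𝓕_t)`: each `𝓕_t` is the universal completion of `𝓕°_t`. The ambient
σ-algebra is `𝓕_T`. -/
def priceFiltration (T : ℝ≥0) :
    Filtration (TimeInterval T) (universalCompletion (rawSigmaAlgebra T (finalTime T))) where
  seq t := universalCompletion (rawSigmaAlgebra T t)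
  mono' := fun _ _ h => universalCompletion_mono (rawSigmaAlgebra_mono T h)
  le' := fun t => universalCompletion_mono (rawSigmaAlgebra_mono T t.2.2)

/-- `τ ∧ t ∈ [0, T]` for `τ ∈ [0, T] ∪ {∞}` and `t ∈ [0, T]`. -/
def truncate {T : ℝ≥0} (τ : WithTop (TimeInterval T)) (t : TimeInterval T) : TimeInterval T :=
  (min τ (t : WithTop (TimeInterval T))).untopD t

/-- A simple trading strategy; the index `n = 0, 1, 2, …` stands for `1, 2, 3, …`. -/
structure SimpleStrategy (T : ℝ≥0) where
  /-- The initial capital. -/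
  initialCapital : ℝ
  /-- The increasing sequence of times at which the strategy trades. -/
  time : ℕ → PricePath T → WithTop (TimeInterval T)
  isStoppingTime : ∀ n, IsStoppingTime (priceFiltration T) (time n)
  time_le_succ : ∀ n ω, time n ω ≤ time (n + 1) ω
  finite_trades : ∀ ω, {n | time n ω ≠ ⊤}.Finite
  /-- The position taken at each of these times. -/
  position : ℕ → PricePath T → ℝ
  position_bounded : ∀ n, ∃ C : ℝ, ∀ ω, |position n ω| ≤ C
  position_measurable : ∀ n, Measurable[(isStoppingTime n).measurableSpace] (position n)

/-- The simple capital process `𝒦^G_t(ω) = c + ∑ₙ hₙ(ω) (ω(τₙ₊₁ ∧ t) - ω(τₙ ∧ t))`. The sum has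
only finitely many nonzero terms for each `ω`. -/
noncomputable def SimpleStrategy.capital {T : ℝ≥0} (G : SimpleStrategy T) (t : TimeInterval T)
    (ω : PricePath T) : ℝ :=
  G.initialCapital + ∑ᶠ n : ℕ, G.position n ω *
    (ω.price (truncate (G.time (n + 1) ω) t) - ω.price (truncate (G.time n ω) t))

/-- `S` is a positive capital process: it is adapted to `(𝓕_t)` and is the sum of a sequence of
positive simple capital processes whose initial capitals form a convergent series. The value `∞`
is allowed. -/
def IsPositiveCapitalProcess {T : ℝ≥0} (S : TimeInterval T → PricePath T → ℝ≥0∞) : Prop :=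
  (∀ t, Measurable[priceFiltration T t] (S t)) ∧
  ∃ G : ℕ → SimpleStrategy T,
    (∀ m t ω, 0 ≤ (G m).capital t ω) ∧
    (Summable fun m => (G m).initialCapital) ∧
    ∀ t ω, S t ω = ∑' m, ENNReal.ofReal ((G m).capital t ω)

/-- A set of price paths is null if some positive capital process with initial value `1` has the
final value `∞` on all of it. -/
def IsNull {T : ℝ≥0} (E : Set (PricePath T)) : Prop :=
  ∃ S : TimeInterval T → PricePath T → ℝ≥0∞, IsPositiveCapitalProcess S ∧
    (∀ ω, S (initialTime T) ω = 1) ∧ ∀ ω ∈ E, S (finalTime T) ω = ∞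

/-- A property of price paths holds almost surely, in the game-theoretic sense, if the set of
price paths where it fails is null. -/
def AlmostSurely {T : ℝ≥0} (p : PricePath T → Prop) : Prop :=
  IsNull {ω | ¬ p ω}

end RightContinuousMarket

/-!
A right-continuous nonnegative path `ω` that is not càdlàg either oscillates, crossing some interval
`[a, b]` with rational endpoints `0 < a < b` upwards infinitely often before some time, or is
unbounded (`exists_upcrossings_or_unbounded_of_not_isCadlag`). In both cases the path can be
exploited by Doob's upcrossing strategy: start with the capital `1`, hold `1 / a` shares from each
visit to `(-∞, a]` until the next visit to `[b, ∞)`, and stop after `k` upcrossings. Since prices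
are nonnegative, the capital never becomes negative, and `k` upcrossings bring it to at least
`k (b - a) / a` (`upcrossing_gains`). On an oscillating path `k` is arbitrary; on an unbounded path
that starts below `a` one has `k = 1` with `b` arbitrary. So each of countably many sets covering
the bad paths allows the unit capital to be multiplied by any factor, and a weighted sum of such
strategies becomes infinite on all of them (`isNull_iUnion`).

The delicate point is that the crossing times are stopping times for the universally completed
filtration, which is not right-continuous. Right-continuity of the paths ensures that the first visit
to a closed set is attained (`hitFrom_le`), but whether it has occurred by time `t` is not decided by
the values at countably many times, since the path may approach the set from the left without
reaching it. Instead of the measurable projection theorem, `aemeasurable_of_isLeast` uses the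
largest measurable minorant of the hitting time with respect to a given probability measure and
shows that it is almost surely a hitting time itself.
-/

namespace RightContinuousMarket

/-! ### Right-continuous processes at random times -/

section RandomTimes

variable {Ω : Type*} {m : MeasurableSpace Ω} {X : ℝ → Ω → ℝ}

theorem measurable_eval_of_rightContinuous (hX : ∀ s, Measurable (X s))
    (hr : ∀ ω s, ContinuousWithinAt (fun r => X r ω) (Ici s) s) {g : Ω → ℝ} (hg : Measurable g) :
    Measurable fun ω => X (g ω) ω := by
  -- `g` is approximated from the right by the random times `d n`, each with countably many values.
  let d : ℕ → Ω → ℝ := fun n ω => (⌊((n : ℝ) + 1) * g ω⌋ + 1) / ((n : ℝ) + 1)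
  have hd : ∀ n, Measurable fun ω => X (d n ω) ω := by
    intro n
    have h1 : Measurable fun p : ℤ × Ω => X (((p.1 : ℝ) + 1) / ((n : ℝ) + 1)) p.2 :=
      measurable_from_prod_countable_right fun k => hX (((k : ℝ) + 1) / ((n : ℝ) + 1))
    have h2 : Measurable fun ω => (⌊((n : ℝ) + 1) * g ω⌋, ω) :=
      (Int.measurable_floor.comp (hg.const_mul _)).prodMk measurable_id
    exact h1.comp h2
  refine measurable_of_tendsto_metrizable hd ?_
  rw [tendsto_pi_nhds]
  intro ω
  have hlow : ∀ n, g ω ≤ d n ω := by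
    intro n
    have hn : (0 : ℝ) < (n : ℝ) + 1 := by positivity
    rw [le_div_iff₀ hn, mul_comm]
    exact (Int.lt_floor_add_one _).le
  have hup : ∀ n, d n ω ≤ g ω + 1 / ((n : ℝ) + 1) := by
    intro n
    have hn : (0 : ℝ) < (n : ℝ) + 1 := by positivity
    have : g ω + 1 / ((n : ℝ) + 1) = (((n : ℝ) + 1) * g ω + 1) / ((n : ℝ) + 1) := by field_simp
    rw [this]
    exact div_le_div_of_nonneg_right (by linarith [Int.floor_le (((n : ℝ) + 1) * g ω)]) hn.le
  have hlim : Tendsto (fun n => d n ω) atTop (𝓝 (g ω)) := by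
    refine tendsto_of_tendsto_of_tendsto_of_le_of_le tendsto_const_nhds ?_ hlow hup
    simpa using tendsto_const_nhds.add (tendsto_one_div_add_atTop_nhds_zero_nat (𝕜 := ℝ))
  exact (hr ω (g ω)).tendsto.comp
    (tendsto_nhdsWithin_iff.2 ⟨hlim, Eventually.of_forall hlow⟩)

/-- The first time `τ ≥ σ` at which a right-continuous process is nonpositive is measurable for the
completed measure. Among the measurable functions below `τ` there is a largest one `ρ` up to null
sets, namely one whose integral is the lower integral of `τ`. If `X` were positive at `ρ` with
positive probability, right-continuity would keep it away from `0` up to some rational `q > ρ` on a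
measurable set of positive measure, and `ρ` could be raised to `q` there. -/
theorem aemeasurable_of_isLeast {μ : Measure Ω} [IsFiniteMeasure μ] (hX : ∀ s, Measurable (X s))
    (hr : ∀ ω s, ContinuousWithinAt (fun r => X r ω) (Ici s) s) {σ τ : Ω → ℝ}
    (hσ : AEMeasurable σ μ) {B : ℝ} (h0 : ∀ ω, 0 ≤ τ ω) (hB : ∀ ω, τ ω ≤ B)
    (hτ : ∀ ω, IsLeast {s | σ ω ≤ s ∧ X s ω ≤ 0} (τ ω)) : AEMeasurable τ μ := by
  obtain ⟨g, hg, hgle, hint⟩ := exists_measurable_le_lintegral_eq μ fun ω => ENNReal.ofReal (τ ω)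
  have hfin : ∫⁻ ω, g ω ∂μ ≠ ∞ := by
    rw [← hint]
    refine ne_top_of_le_ne_top (b := ∫⁻ _, ENNReal.ofReal B ∂μ) ?_
      (lintegral_mono fun ω => ENNReal.ofReal_le_ofReal (hB ω))
    rw [lintegral_const]
    exact ENNReal.mul_ne_top ENNReal.ofReal_ne_top (measure_ne_top _ _)
  have hgtop : ∀ ω, g ω ≠ ∞ := fun ω => ne_top_of_le_ne_top ENNReal.ofReal_ne_top (hgle ω)
  have hgτ : ∀ ω, (g ω).toReal ≤ τ ω := fun ω =>
    ENNReal.toReal_le_of_le_ofReal (h0 ω) (hgle ω)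
  have hmax : ∀ ρ : Ω → ℝ, Measurable ρ → (∀ ω, (g ω).toReal ≤ ρ ω) → (∀ᵐ ω ∂μ, ρ ω ≤ τ ω) →
      ∀ᵐ ω ∂μ, ρ ω = (g ω).toReal := by
    intro ρ hρ hgρ hρτ
    have := ae_eq_of_ae_le_of_lintegral_le (μ := μ) (f := g) (g := fun ω => ENNReal.ofReal (ρ ω))
      (Eventually.of_forall fun ω => (ENNReal.le_ofReal_iff_toReal_le (hgtop ω)
        (ENNReal.toReal_nonneg.trans (hgρ ω))).2 (hgρ ω)) hfin hρ.ennreal_ofReal.aemeasurable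
      (by
        rw [← hint]
        exact lintegral_mono_ae (hρτ.mono fun ω h => ENNReal.ofReal_le_ofReal h))
    filter_upwards [this] with ω hω
    rw [hω, ENNReal.toReal_ofReal (ENNReal.toReal_nonneg.trans (hgρ ω))]
  let ρ : Ω → ℝ := fun ω => max (g ω).toReal (hσ.mk σ ω)
  have hρ : Measurable ρ := hg.ennreal_toReal.max hσ.measurable_mk
  have hρτ : ∀ᵐ ω ∂μ, ρ ω ≤ τ ω := by
    filter_upwards [hσ.ae_eq_mk] with ω hω
    exact max_le (hgτ ω) (hω ▸ (hτ ω).1.1)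
  let A : ℚ × ℚ → Set Ω := fun p =>
    {ω | ρ ω < p.1} ∩ ⋂ r : ℚ, {ω | r < ρ ω} ∪ ({_ω | p.1 ≤ r} ∪ {ω | (p.2 : ℝ) ≤ X r ω})
  have hA : ∀ p, MeasurableSet (A p) := fun p =>
    (measurableSet_lt hρ measurable_const).inter <| MeasurableSet.iInter fun r =>
      (measurableSet_lt measurable_const hρ).union
        ((MeasurableSet.const _).union (measurableSet_le measurable_const (hX r)))
  have hA0 : ∀ p : ℚ × ℚ, 0 < p.2 → ∀ᵐ ω ∂μ, ω ∉ A p := by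
    classical
    rintro ⟨q, ε⟩ hε
    have hε' : (0 : ℝ) < ε := by exact_mod_cast hε
    have key := hmax ((A (q, ε)).piecewise (fun _ => (q : ℝ)) ρ)
      (Measurable.piecewise (hA _) measurable_const hρ)
      (by
        intro ω
        by_cases hω : ω ∈ A (q, ε)
        · rw [piecewise_eq_of_mem _ _ _ hω]
          exact (le_max_left _ _).trans hω.1.le
        · rw [piecewise_eq_of_notMem _ _ _ hω]
          exact le_max_left _ _)
      (by
        filter_upwards [hρτ] with ω hω
        by_cases hωA : ω ∈ A (q, ε)
        · rw [piecewise_eq_of_mem _ _ _ hωA]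
          by_contra! hlt
          -- just after `τ < q` there would be rational times at which `X` is small
          have hev : ∀ᶠ s in 𝓝[≥] (τ ω), X s ω < ε :=
            (hr ω (τ ω)).eventually_lt_const ((hτ ω).1.2.trans_lt hε')
          obtain ⟨u, hu, hsub⟩ := mem_nhdsGE_iff_exists_Ico_subset.1 hev
          obtain ⟨r, hr1, hr2⟩ := exists_rat_btwn (lt_min hu hlt)
          have h1 : X r ω < ε := hsub ⟨hr1.le, hr2.trans_le (min_le_left _ _)⟩
          rcases mem_iInter.1 hωA.2 r with h | h | h
          · exact absurd (hω.trans_lt hr1) (not_lt.2 (le_of_lt h))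
          · have h3 : (r : ℝ) < q := hr2.trans_le (min_le_right _ _)
            have h4 : (q : ℝ) ≤ r := by exact_mod_cast h
            linarith
          · exact absurd h1 (not_lt.2 h)
        · rwa [piecewise_eq_of_notMem _ _ _ hωA])
    filter_upwards [key] with ω hω hωA
    rw [piecewise_eq_of_mem _ _ _ hωA] at hω
    have h1 : ρ ω < q := hωA.1
    have h2 : (g ω).toReal ≤ ρ ω := le_max_left _ _
    linarith
  have hA0' : ∀ᵐ ω ∂μ, ∀ p : ℚ × ℚ, 0 < p.2 → ω ∉ A p := by
    rw [ae_all_iff]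
    intro p
    by_cases hp : 0 < p.2
    · filter_upwards [hA0 p hp] with ω hω _ using hω
    · exact Eventually.of_forall fun ω h => absurd h hp
  refine ⟨ρ, hρ, ?_⟩
  filter_upwards [hA0', hρτ, hσ.ae_eq_mk] with ω h1 h2 h3
  refine le_antisymm ((hτ ω).2 ⟨h3.trans_le (le_max_right _ _), ?_⟩) h2
  by_contra! hpos
  obtain ⟨ε, hε0, hε⟩ := exists_rat_btwn hpos
  have hev : ∀ᶠ s in 𝓝[≥] (ρ ω), (ε : ℝ) < X s ω := (hr ω (ρ ω)).eventually_const_lt hε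
  obtain ⟨u, hu, hsub⟩ := mem_nhdsGE_iff_exists_Ico_subset.1 hev
  obtain ⟨q, hq1, hq2⟩ := exists_rat_btwn (mem_Ioi.1 hu)
  refine h1 (q, ε) (by exact_mod_cast hε0) ⟨hq1, mem_iInter.2 fun r => ?_⟩
  by_cases hr1 : r < ρ ω
  · exact Or.inl hr1
  by_cases hr2 : q ≤ r
  · exact Or.inr (Or.inl hr2)
  · have hr3 : (r : ℝ) < q := by exact_mod_cast not_le.1 hr2
    have hr4 : (ε : ℝ) < X r ω := hsub ⟨not_lt.1 hr1, hr3.trans hq2⟩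
    exact Or.inr (Or.inr hr4.le)

end RandomTimes

variable {T : ℝ≥0}

/-! ### Stopped paths and the capital of a simple strategy -/

/-- The path `ω` stopped at time `t`, extended to all real times by the values at the endpoints. -/
noncomputable def PricePath.stopped (ω : PricePath T) (t : TimeInterval T) (s : ℝ) : ℝ :=
  ω.price (min (projIcc 0 (T : ℝ) T.coe_nonneg s) t)

theorem PricePath.stopped_coe (ω : PricePath T) {s t : TimeInterval T} (h : s ≤ t) :
    ω.stopped t (s : ℝ) = ω.price s := by
  rw [PricePath.stopped, projIcc_val, min_eq_left h]

theorem measurable_price {s t : TimeInterval T} (h : s ≤ t) :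
    Measurable[rawSigmaAlgebra T t] fun ω : PricePath T => ω.price s := by
  have h1 : MeasurableSpace.comap (fun ω : PricePath T => ω.price s) (borel ℝ) ≤
      rawSigmaAlgebra T t :=
    le_iSup₂_of_le (f := fun (s : TimeInterval T) (_ : s ≤ t) =>
      MeasurableSpace.comap (fun ω : PricePath T => ω.price s) (borel ℝ)) s h le_rfl
  rw [measurable_iff_comap_le, BorelSpace.measurable_eq (α := ℝ)]
  exact h1

theorem measurable_stopped (t : TimeInterval T) (s : ℝ) :
    Measurable[rawSigmaAlgebra T t] fun ω : PricePath T => ω.stopped t s :=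
  measurable_price (min_le_right _ _)

theorem PricePath.stopped_rightContinuous (ω : PricePath T) (t : TimeInterval T) (s : ℝ) :
    ContinuousWithinAt (ω.stopped t) (Ici s) s := by
  have h1 : Continuous fun s : ℝ => min (projIcc 0 (T : ℝ) T.coe_nonneg s) t :=
    continuous_projIcc.min continuous_const
  exact (ω.rightContinuous _).comp h1.continuousWithinAt
    fun r hr => min_le_min_right t (monotone_projIcc _ hr)

theorem le_universalCompletion {α : Type*} (m : MeasurableSpace α) : m ≤ universalCompletion m :=
  fun _ hs _ _ => hs.nullMeasurableSet

theorem truncate_of_le {τ : WithTop (TimeInterval T)} {t : TimeInterval T}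
    (h : (t : WithTop (TimeInterval T)) ≤ τ) : truncate τ t = t := by
  rw [truncate, min_eq_right h, WithTop.untopD_coe]

theorem truncate_coe (s t : TimeInterval T) :
    truncate (s : WithTop (TimeInterval T)) t = min s t := by
  rw [truncate, ← WithTop.coe_min, WithTop.untopD_coe]

theorem truncate_le_iff {τ : WithTop (TimeInterval T)} {s t : TimeInterval T} (h : s < t) :
    truncate τ t ≤ s ↔ τ ≤ s := by
  cases τ with
  | top => simp [truncate_of_le le_top, h]
  | coe r => simp [truncate_coe, h]

theorem truncate_le (τ : WithTop (TimeInterval T)) (t : TimeInterval T) : truncate τ t ≤ t := by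
  cases τ with
  | top => exact (truncate_of_le le_top).le
  | coe r => rw [truncate_coe]; exact min_le_right _ _

theorem measurable_truncate {τ : PricePath T → WithTop (TimeInterval T)}
    (hτ : IsStoppingTime (priceFiltration T) τ) (t : TimeInterval T) :
    Measurable[priceFiltration T t] fun ω => truncate (τ ω) t := by
  let _ : MeasurableSpace (PricePath T) := priceFiltration T t
  refine measurable_of_Iic fun s => ?_
  rcases lt_or_ge s t with h | h
  · have : (fun ω => truncate (τ ω) t) ⁻¹' Iic s = {ω | τ ω ≤ s} := by
      ext ω
      exact truncate_le_iff h
    rw [this]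
    exact (priceFiltration T).mono h.le _ (hτ s)
  · have : (fun ω => truncate (τ ω) t) ⁻¹' Iic s = univ :=
      eq_univ_of_forall fun ω => (truncate_le _ _).trans h
    rw [this]
    exact @MeasurableSet.univ _ (priceFiltration T t)

theorem measurable_price_truncate {τ : PricePath T → WithTop (TimeInterval T)}
    (hτ : IsStoppingTime (priceFiltration T) τ) (t : TimeInterval T) :
    Measurable[priceFiltration T t] fun ω => ω.price (truncate (τ ω) t) := by
  have h := @measurable_eval_of_rightContinuous _ (priceFiltration T t)
    (fun s (ω : PricePath T) => ω.stopped t s)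
    (fun s => (measurable_stopped t s).mono (le_universalCompletion _) le_rfl)
    (fun ω s => ω.stopped_rightContinuous t s) (fun ω => (truncate (τ ω) t : ℝ))
    (measurable_subtype_coe.comp (measurable_truncate hτ t))
  refine (congrArg (fun f => Measurable[priceFiltration T t] f) (funext fun ω => ?_)).mp h
  exact ω.stopped_coe (truncate_le _ _)

namespace SimpleStrategy

/-- The gain up to time `t` from the position taken at the `n`-th trading time. -/
noncomputable def gain (G : SimpleStrategy T) (t : TimeInterval T) (ω : PricePath T) (n : ℕ) : ℝ :=
  G.position n ω * (ω.price (truncate (G.time (n + 1) ω) t) - ω.price (truncate (G.time n ω) t))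

theorem time_monotone (G : SimpleStrategy T) (ω : PricePath T) : Monotone fun n => G.time n ω :=
  monotone_nat_of_le_succ fun n => G.time_le_succ n ω

theorem gain_eq_zero (G : SimpleStrategy T) {t : TimeInterval T} {ω : PricePath T} {n : ℕ}
    (h : (t : WithTop (TimeInterval T)) ≤ G.time n ω) : G.gain t ω n = 0 := by
  rw [gain, truncate_of_le h, truncate_of_le (h.trans (G.time_le_succ n ω)), sub_self, mul_zero]

theorem capital_eq_sum (G : SimpleStrategy T) (t : TimeInterval T) {ω : PricePath T} {N : ℕ}
    (h : G.time N ω = ⊤) :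
    G.capital t ω = G.initialCapital + ∑ n ∈ Finset.range N, G.gain t ω n := by
  rw [capital]
  congr 1
  refine finsum_eq_sum_of_support_subset (f := G.gain t ω) fun n hn => ?_
  rw [Finset.coe_range, mem_Iio]
  by_contra! hle
  refine hn (G.gain_eq_zero ?_)
  exact le_top.trans (h.symm.le.trans (G.time_monotone ω hle))

theorem exists_time_eq_top (G : SimpleStrategy T) (ω : PricePath T) :
    ∃ N, ∀ n, N ≤ n → G.time n ω = ⊤ := by
  obtain ⟨N, hN⟩ := (G.finite_trades ω).bddAbove
  refine ⟨N + 1, fun n hn => ?_⟩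
  by_contra h
  have : n ≤ N := hN h
  omega

theorem measurable_gain (G : SimpleStrategy T) (t : TimeInterval T) (n : ℕ) :
    Measurable[priceFiltration T t] fun ω => G.gain t ω n := by
  -- on `{t < τ n}` the gain vanishes, so the position matters only where it is known at time `t`
  have h1 : Measurable[priceFiltration T t]
      ({ω | G.time n ω ≤ t}.indicator (G.position n)) := by
    intro B hB
    rw [indicator_preimage]
    have h2 : MeasurableSet[priceFiltration T t] (G.position n ⁻¹' B ∩ {ω | G.time n ω ≤ t}) :=
      (G.position_measurable n hB).2 t
    have h3 : MeasurableSet[priceFiltration T t]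
        ((0 : PricePath T → ℝ) ⁻¹' B \ {ω | G.time n ω ≤ t}) :=
      (@measurable_const _ _ _ (priceFiltration T t) (0 : ℝ) B hB).diff (G.isStoppingTime n t)
    exact h2.union h3
  have h4 := h1.mul ((measurable_price_truncate (G.isStoppingTime (n + 1)) t).sub
    (measurable_price_truncate (G.isStoppingTime n) t))
  refine (congrArg (fun f => Measurable[priceFiltration T t] f) (funext fun ω => ?_)).mp h4
  by_cases h : G.time n ω ≤ t
  · simp only [Pi.mul_apply, Pi.sub_apply, gain]
    rw [indicator_of_mem (show ω ∈ {ω | G.time n ω ≤ t} from h)]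
  · rw [G.gain_eq_zero (not_le.1 h).le]
    simp only [Pi.mul_apply]
    rw [indicator_of_notMem (show ω ∉ {ω | G.time n ω ≤ t} from h), zero_mul]

theorem measurable_capital (G : SimpleStrategy T) (t : TimeInterval T) :
    Measurable[priceFiltration T t] (G.capital t) := by
  refine @measurable_of_tendsto_metrizable _ _ (priceFiltration T t) _ _ _ _
    (fun N ω => G.initialCapital + ∑ n ∈ Finset.range N, G.gain t ω n) _ (fun N => ?_) ?_
  · exact (@measurable_const _ _ _ (priceFiltration T t) _).add
      (@Finset.measurable_sum _ _ _ _ _ _ (priceFiltration T t) _ _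
        fun n _ => G.measurable_gain t n)
  · rw [tendsto_pi_nhds]
    intro ω
    obtain ⟨N, hN⟩ := G.exists_time_eq_top ω
    refine tendsto_const_nhds.congr' ?_
    filter_upwards [eventually_ge_atTop N] with n hn
    exact G.capital_eq_sum t (hN n hn)

theorem capital_initialTime (G : SimpleStrategy T) (ω : PricePath T) :
    G.capital (initialTime T) ω = G.initialCapital := by
  have h : ∀ τ : WithTop (TimeInterval T), truncate τ (initialTime T) = initialTime T :=
    fun τ => le_antisymm (truncate_le _ _) (truncate τ (initialTime T)).2.1
  simp [capital, h]

/-- The strategy `G` with all stakes multiplied by `w`. -/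
noncomputable def scale (w : ℝ) (G : SimpleStrategy T) : SimpleStrategy T where
  initialCapital := w * G.initialCapital
  time := G.time
  isStoppingTime := G.isStoppingTime
  time_le_succ := G.time_le_succ
  finite_trades := G.finite_trades
  position n ω := w * G.position n ω
  position_bounded n := by
    obtain ⟨C, hC⟩ := G.position_bounded n
    refine ⟨|w| * C, fun ω => ?_⟩
    rw [abs_mul]
    exact mul_le_mul_of_nonneg_left (hC ω) (abs_nonneg w)
  position_measurable n := (G.position_measurable n).const_mul w

theorem capital_scale (w : ℝ) (G : SimpleStrategy T) (t : TimeInterval T) (ω : PricePath T) :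
    (G.scale w).capital t ω = w * G.capital t ω := by
  obtain ⟨N, hN⟩ := G.exists_time_eq_top ω
  rw [G.capital_eq_sum t (hN N le_rfl), (G.scale w).capital_eq_sum t (hN N le_rfl), mul_add,
    Finset.mul_sum]
  refine congrArg₂ _ rfl (Finset.sum_congr rfl fun n _ => ?_)
  simp only [gain, scale]
  ring

end SimpleStrategy

/-! ### A criterion for null sets -/

/-- A countable union of sets is null if on each of them the unit capital can be multiplied by
arbitrarily large factors. The `m`-th strategy receives the capital `2⁻ᵐ⁻¹` and brings it to at
least `1`, each of the sets being served by infinitely many `m`. -/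
theorem isNull_iUnion {ι : Type*} [Countable ι] [Nonempty ι] {E : ι → Set (PricePath T)}
    (h : ∀ i, ∀ K : ℝ, ∃ G : SimpleStrategy T, G.initialCapital = 1 ∧
      (∀ t ω, 0 ≤ G.capital t ω) ∧ ∀ ω ∈ E i, K ≤ G.capital (finalTime T) ω) :
    IsNull (⋃ i, E i) := by
  choose G hG1 hG0 hGK using h
  obtain ⟨f, hf⟩ := exists_surjective_nat (ι × ℕ)
  let w : ℕ → ℝ := fun m => (1 / 2) ^ (m + 1)
  have hw : ∀ m, 0 < w m := fun m => by positivity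
  have hsum : HasSum w 1 := by
    simpa [w, pow_succ] using hasSum_geometric_two.mul_right (1 / 2 : ℝ)
  let H : ℕ → SimpleStrategy T := fun m => (G (f m).1 (w m)⁻¹).scale (w m)
  have hHc : ∀ m, (H m).initialCapital = w m := fun m => by simp [H, SimpleStrategy.scale, hG1]
  have hH0 : ∀ m t ω, 0 ≤ (H m).capital t ω := fun m t ω => by
    rw [SimpleStrategy.capital_scale]
    exact mul_nonneg (hw m).le (hG0 _ _ _ _)
  refine ⟨fun t ω => ∑' m, ENNReal.ofReal ((H m).capital t ω), ⟨fun t => ?_, H, hH0, ?_,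
    fun t ω => rfl⟩, fun ω => ?_, fun ω hω => ?_⟩
  · let _ : MeasurableSpace (PricePath T) := priceFiltration T t
    exact Measurable.tsum fun m => ((H m).measurable_capital t).ennreal_ofReal
  · simp_rw [hHc]
    exact hsum.summable
  · simp_rw [SimpleStrategy.capital_initialTime, hHc]
    rw [← ENNReal.ofReal_tsum_of_nonneg (fun m => (hw m).le) hsum.summable, hsum.tsum_eq,
      ENNReal.ofReal_one]
  · obtain ⟨i, hi⟩ := mem_iUnion.1 hω
    by_contra hne
    have hfin := ENNReal.finite_const_le_of_tsum_ne_top hne one_ne_zero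
    have hsub : (range fun n : ℕ => (i, n)) ⊆
        f '' {m | 1 ≤ ENNReal.ofReal ((H m).capital (finalTime T) ω)} := by
      rintro _ ⟨n, rfl⟩
      obtain ⟨m, hm⟩ := hf (i, n)
      refine ⟨m, ?_, hm⟩
      rw [mem_ofPred_eq, ENNReal.one_le_ofReal, SimpleStrategy.capital_scale]
      have h1 := hGK (f m).1 (w m)⁻¹ ω (by rw [hm]; exact hi)
      calc (1 : ℝ) = w m * (w m)⁻¹ := (mul_inv_cancel₀ (hw m).ne').symm
        _ ≤ _ := mul_le_mul_of_nonneg_left h1 (hw m).le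
    exact infinite_range_of_injective (fun n n' h => (Prod.mk.inj h).2)
      ((hfin.image f).subset hsub)

/-! ### Hitting times -/

open Classical in
/-- The first time `s ≥ σ` at which the path `ω` is in `C`, or `∞` if there is no first time. -/
noncomputable def hitFrom (C : Set ℝ) (σ : WithTop (TimeInterval T)) (ω : PricePath T) :
    WithTop (TimeInterval T) :=
  if h : ∃ s, IsLeast {s : TimeInterval T | σ ≤ s ∧ ω.price s ∈ C} s then
    (h.choose : WithTop (TimeInterval T)) else ⊤

section Hitting

variable {C : Set ℝ} {σ : WithTop (TimeInterval T)} {ω : PricePath T} {s : TimeInterval T}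

theorem isLeast_of_hitFrom_eq (h : hitFrom C σ ω = s) :
    IsLeast {s : TimeInterval T | σ ≤ s ∧ ω.price s ∈ C} s := by
  rw [hitFrom] at h
  split_ifs at h with hex
  swap
  · exact absurd h WithTop.top_ne_coe
  have h2 := hex.choose_spec
  rwa [WithTop.coe_inj.1 h] at h2

theorem le_hitFrom : σ ≤ hitFrom C σ ω := by
  cases h : hitFrom C σ ω with
  | top => exact le_top
  | coe s => exact (isLeast_of_hitFrom_eq h).1.1

/-- For closed `C` the infimum of the hitting times is attained, by right-continuity. -/
theorem hitFrom_le (hC : IsClosed C) (h1 : σ ≤ s) (h2 : ω.price s ∈ C) : hitFrom C σ ω ≤ s := by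
  let S : Set (TimeInterval T) := {s | σ ≤ s ∧ ω.price s ∈ C}
  have hS : s ∈ S := ⟨h1, h2⟩
  obtain ⟨u, hu⟩ := isClosed_closure.isCompact.exists_isLeast ⟨s, subset_closure hS⟩
  have huS : IsLeast S u := by
    refine ⟨⟨?_, ?_⟩, fun r hr => hu.2 (subset_closure hr)⟩
    · cases σ with
      | top => exact absurd h1 (by simp)
      | coe a =>
        have h3 : S ⊆ Ici a := fun r hr => WithTop.coe_le_coe.1 hr.1
        exact WithTop.coe_le_coe.2 (closure_minimal h3 isClosed_Ici hu.1)
    · have h3 : ContinuousWithinAt ω.price S u :=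
        (ω.rightContinuous u).mono fun r hr => hu.2 (subset_closure hr)
      refine closure_minimal ?_ hC (h3.mem_closure_image hu.1)
      rintro _ ⟨r, hr, rfl⟩
      exact hr.2
  have hex : ∃ s, IsLeast {s : TimeInterval T | σ ≤ s ∧ ω.price s ∈ C} s := ⟨u, huS⟩
  rw [hitFrom, dif_pos hex]
  exact WithTop.coe_le_coe.2 (hex.choose_spec.2 hS)

end Hitting

open Classical in
/-- A time in `[0, T] ∪ {∞}` as a real number, with all the values after the horizon `t` replaced
by `t + 1`. -/
noncomputable def cutoff (t : TimeInterval T) (τ : WithTop (TimeInterval T)) : ℝ :=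
  if τ ≤ t then ((τ.untopD t : TimeInterval T) : ℝ) else t + 1

theorem cutoff_coe {s t : TimeInterval T} (h : s ≤ t) :
    cutoff t (s : WithTop (TimeInterval T)) = s := by
  rw [cutoff, if_pos (WithTop.coe_le_coe.2 h), WithTop.untopD_coe]

theorem cutoff_of_lt {t : TimeInterval T} {τ : WithTop (TimeInterval T)} (h : t < τ) :
    cutoff t τ = t + 1 := if_neg (not_le.2 h)

theorem coe_or_lt (t : TimeInterval T) (τ : WithTop (TimeInterval T)) :
    (∃ s ≤ t, τ = (s : WithTop (TimeInterval T))) ∨ (t : WithTop (TimeInterval T)) < τ := by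
  rcases le_or_gt τ t with h | h
  · lift τ to TimeInterval T using ne_top_of_le_ne_top WithTop.coe_ne_top h
    exact Or.inl ⟨τ, WithTop.coe_le_coe.1 h, rfl⟩
  · exact Or.inr h

theorem cutoff_le_iff {t : TimeInterval T} {τ : WithTop (TimeInterval T)} :
    cutoff t τ ≤ t ↔ τ ≤ t := by
  rcases coe_or_lt t τ with ⟨s, hs, rfl⟩ | h
  · rw [cutoff_coe hs]
    simp [hs]
  · rw [cutoff_of_lt h]
    exact iff_of_false (by simp) (not_le.2 h)

theorem cutoff_mem_Icc (t : TimeInterval T) (τ : WithTop (TimeInterval T)) :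
    cutoff t τ ∈ Icc (0 : ℝ) (t + 1) := by
  have ht : (0 : ℝ) ≤ t := t.2.1
  rcases coe_or_lt t τ with ⟨s, hs, rfl⟩ | h
  · rw [cutoff_coe hs]
    have h1 : (s : ℝ) ≤ t := hs
    exact ⟨s.2.1, by linarith⟩
  · rw [cutoff_of_lt h]
    exact ⟨by linarith, le_rfl⟩

/-- The distance of the path stopped at `t` from the set `C`, killed at time `t + 1`. The value `-1`
from then on makes `t + 1` a hitting time of `(-∞, 0]` for the paths that miss `C` up to `t`. -/
noncomputable def killedDist (C : Set ℝ) (t : TimeInterval T) (s : ℝ) (ω : PricePath T) : ℝ :=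
  if s < t + 1 then Metric.infDist (ω.stopped t s) C else -1

theorem measurable_killedDist (C : Set ℝ) (t : TimeInterval T) (s : ℝ) :
    Measurable[rawSigmaAlgebra T t] (killedDist C t s) := by
  unfold killedDist
  split_ifs
  · exact (Metric.continuous_infDist_pt C).measurable.comp (measurable_stopped t s)
  · exact @measurable_const _ _ _ (rawSigmaAlgebra T t) _

theorem killedDist_rightContinuous (C : Set ℝ) (t : TimeInterval T) (ω : PricePath T) (s : ℝ) :
    ContinuousWithinAt (fun r => killedDist C t r ω) (Ici s) s := by
  rcases lt_or_ge s (t + 1) with h | h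
  · refine ((Metric.continuous_infDist_pt C).continuousAt.comp_continuousWithinAt
      (ω.stopped_rightContinuous t s)).congr_of_eventuallyEq ?_ (if_pos h)
    filter_upwards [mem_nhdsWithin_of_mem_nhds (Iio_mem_nhds h)] with r hr
    exact if_pos hr
  · exact (continuousWithinAt_const (b := (-1 : ℝ))).congr (fun r hr => if_neg (not_lt.2 (h.trans hr)))
      (if_neg (not_lt.2 h))

theorem isLeast_cutoff_hitFrom {C : Set ℝ} (hC : IsClosed C) (hne : C.Nonempty)
    (t : TimeInterval T) (σ : WithTop (TimeInterval T)) (ω : PricePath T) :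
    IsLeast {s | cutoff t σ ≤ s ∧ killedDist C t s ω ≤ 0} (cutoff t (hitFrom C σ ω)) := by
  have hmem : ∀ x, Metric.infDist x C ≤ 0 ↔ x ∈ C := fun x => by
    rw [hC.mem_iff_infDist_zero hne]
    exact ⟨fun h => le_antisymm h Metric.infDist_nonneg, fun h => h.le⟩
  have ht : (0 : ℝ) ≤ t := t.2.1
  constructor
  · rcases coe_or_lt t (hitFrom C σ ω) with ⟨s, hs, h⟩ | h
    · have hl := isLeast_of_hitFrom_eq h
      have hσ : σ ≤ s := hl.1.1
      lift σ to TimeInterval T using ne_top_of_le_ne_top WithTop.coe_ne_top hσ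
      rw [h, cutoff_coe hs]
      have hσ' : σ ≤ s := WithTop.coe_le_coe.1 hσ
      refine ⟨by rw [cutoff_coe (hσ'.trans hs)]; exact hσ', ?_⟩
      have hs' : (s : ℝ) ≤ t := hs
      rw [killedDist, if_pos (by linarith), ω.stopped_coe hs, hmem]
      exact hl.1.2
    · rw [cutoff_of_lt h]
      refine ⟨(cutoff_mem_Icc t σ).2, ?_⟩
      rw [killedDist, if_neg (lt_irrefl _)]
      norm_num
  · rintro r ⟨hr1, hr2⟩
    rcases lt_or_ge r (t + 1) with h | h
    · rw [killedDist, if_pos h, hmem] at hr2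
      rcases coe_or_lt t σ with ⟨a, ha, rfl⟩ | h'
      · rw [cutoff_coe ha] at hr1
        have h1 : a ≤ min (projIcc 0 (T : ℝ) T.coe_nonneg r) t := by
          refine le_min ?_ ha
          have := monotone_projIcc T.coe_nonneg hr1
          rwa [projIcc_val] at this
        have h2 : hitFrom C a ω ≤ _ := hitFrom_le hC (WithTop.coe_le_coe.2 h1) hr2
        have h3 : ((min (projIcc 0 (T : ℝ) T.coe_nonneg r) t : TimeInterval T) : ℝ) ≤ r := by
          refine (show _ ≤ ((projIcc 0 (T : ℝ) T.coe_nonneg r : TimeInterval T) : ℝ) from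
            min_le_left _ _).trans ?_
          rw [coe_projIcc]
          exact max_le (a.2.1.trans hr1) (min_le_right _ _)
        obtain ⟨v, hv⟩ := WithTop.ne_top_iff_exists.1 (ne_top_of_le_ne_top WithTop.coe_ne_top h2)
        rw [← hv] at h2 ⊢
        have h4 := WithTop.coe_le_coe.1 h2
        rw [cutoff_coe (h4.trans (min_le_right _ _))]
        exact (show (v : ℝ) ≤ _ from h4).trans h3
      · rw [cutoff_of_lt h'] at hr1
        linarith
    · exact (cutoff_mem_Icc t _).2.trans h

theorem aemeasurable_cutoff_hitFrom {C : Set ℝ} (hC : IsClosed C) (hne : C.Nonempty)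
    {t : TimeInterval T} {μ : Measure[rawSigmaAlgebra T t] (PricePath T)} (hμ : IsProbabilityMeasure μ)
    {σ : PricePath T → WithTop (TimeInterval T)} (hσ : AEMeasurable (fun ω => cutoff t (σ ω)) μ) :
    AEMeasurable (fun ω => cutoff t (hitFrom C (σ ω) ω)) μ :=
  aemeasurable_of_isLeast (measurable_killedDist C t) (killedDist_rightContinuous C t) hσ
    (fun _ => (cutoff_mem_Icc t _).1) (fun _ => (cutoff_mem_Icc t _).2)
    fun ω => isLeast_cutoff_hitFrom hC hne t (σ ω) ω

/-! ### Crossing times -/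

/-- The sets that a path has to visit alternately in order to upcross `[a, b]`. -/
def crossingTarget (a b : ℝ) (n : ℕ) : Set ℝ := if Even n then Iic a else Ici b

theorem isClosed_crossingTarget (a b : ℝ) (n : ℕ) : IsClosed (crossingTarget a b n) := by
  unfold crossingTarget
  split_ifs
  exacts [isClosed_Iic, isClosed_Ici]

theorem crossingTarget_nonempty (a b : ℝ) (n : ℕ) : (crossingTarget a b n).Nonempty := by
  unfold crossingTarget
  split_ifs
  exacts [nonempty_Iic, nonempty_Ici]

/-- The times at which the path completes its moves to `(-∞, a]` (even index) and `[b, ∞)`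
(odd index), in alternation. -/
noncomputable def crossingTime (a b : ℝ) (ω : PricePath T) : ℕ → WithTop (TimeInterval T)
  | 0 => hitFrom (crossingTarget a b 0) (initialTime T) ω
  | n + 1 => hitFrom (crossingTarget a b (n + 1)) (crossingTime a b ω n) ω

theorem crossingTime_monotone (a b : ℝ) (ω : PricePath T) : Monotone (crossingTime a b ω) :=
  monotone_nat_of_le_succ fun _ => le_hitFrom

theorem price_crossingTime_mem {a b : ℝ} {ω : PricePath T} {n : ℕ} {s : TimeInterval T}
    (h : crossingTime a b ω n = s) : ω.price s ∈ crossingTarget a b n := by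
  cases n with
  | zero => exact (isLeast_of_hitFrom_eq h).1.2
  | succ n => exact (isLeast_of_hitFrom_eq h).1.2

theorem isStoppingTime_crossingTime (a b : ℝ) (n : ℕ) :
    IsStoppingTime (priceFiltration T) fun ω => crossingTime a b ω n := by
  intro t μ hμ
  have h : AEMeasurable (fun ω => cutoff t (crossingTime a b ω n)) μ := by
    induction n with
    | zero =>
      exact aemeasurable_cutoff_hitFrom (isClosed_crossingTarget a b _)
        (crossingTarget_nonempty a b _) hμ aemeasurable_const
    | succ n ih =>
      exact aemeasurable_cutoff_hitFrom (isClosed_crossingTarget a b _)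
        (crossingTarget_nonempty a b _) hμ ih
  have h2 : {ω : PricePath T | crossingTime a b ω n ≤ t} =
      (fun ω => cutoff t (crossingTime a b ω n)) ⁻¹' Iic (t : ℝ) := by
    ext ω
    exact cutoff_le_iff.symm
  rw [h2]
  exact h.nullMeasurableSet_preimage measurableSet_Iic

/-! ### Betting on upcrossings -/

/-- The strategy that starts with the capital `1` and holds `1 / a` shares during the first `k`
upcrossings of `[a, b]`. -/
noncomputable def upcrossingStrategy (T : ℝ≥0) (a b : ℝ) (k : ℕ) : SimpleStrategy T where
  initialCapital := 1
  time n ω := if n < 2 * k then crossingTime a b ω n else ⊤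
  isStoppingTime n := by
    split_ifs
    · exact isStoppingTime_crossingTime a b n
    · intro t
      simp
  time_le_succ n ω := by
    by_cases h : n + 1 < 2 * k
    · rw [if_pos h, if_pos (by omega)]
      exact crossingTime_monotone a b ω n.le_succ
    · rw [if_neg h]
      exact le_top
  finite_trades ω := (finite_Iio (2 * k)).subset fun n hn => by
    by_contra h
    exact hn (if_neg h)
  position n _ := if Even n then a⁻¹ else 0
  position_bounded n := ⟨|if Even n then a⁻¹ else 0|, fun _ => le_rfl⟩
  position_measurable _ := @measurable_const _ _ _ (_) _

theorem capital_upcrossingStrategy (a b : ℝ) (k : ℕ) (t : TimeInterval T) (ω : PricePath T) :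
    (upcrossingStrategy T a b k).capital t ω = 1 + a⁻¹ * ∑ j ∈ Finset.range k,
      (ω.price (truncate (crossingTime a b ω (2 * j + 1)) t) -
        ω.price (truncate (crossingTime a b ω (2 * j)) t)) := by
  rw [SimpleStrategy.capital_eq_sum (N := 2 * k) _ _ (if_neg (lt_irrefl _)), Finset.mul_sum]
  refine congrArg₂ _ rfl ?_
  have key : ∀ i ≤ k, ∑ n ∈ Finset.range (2 * i), (upcrossingStrategy T a b k).gain t ω n =
      ∑ j ∈ Finset.range i, a⁻¹ * (ω.price (truncate (crossingTime a b ω (2 * j + 1)) t) -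
        ω.price (truncate (crossingTime a b ω (2 * j)) t)) := by
    intro i
    induction i with
    | zero => simp
    | succ i ih =>
      intro hi
      rw [show 2 * (i + 1) = 2 * i + 1 + 1 by ring, Finset.sum_range_succ, Finset.sum_range_succ,
        Finset.sum_range_succ, ih (by omega)]
      have h1 : 2 * i < 2 * k := by omega
      have h2 : 2 * i + 1 < 2 * k := by omega
      simp [SimpleStrategy.gain, upcrossingStrategy, h1, h2]
  exact key k le_rfl

section Upcrossings

variable {a b : ℝ} {t : TimeInterval T} {ω : PricePath T}

theorem price_truncate_crossingTime_even {j : ℕ} (h : crossingTime a b ω (2 * j) ≤ t) :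
    ω.price (truncate (crossingTime a b ω (2 * j)) t) ≤ a := by
  rcases coe_or_lt t (crossingTime a b ω (2 * j)) with ⟨s, hs, hs'⟩ | h'
  · rw [hs', truncate_coe, min_eq_left hs]
    simpa [crossingTarget] using price_crossingTime_mem hs'
  · exact absurd h (not_le.2 h')

theorem price_truncate_crossingTime_odd {j : ℕ} (h : crossingTime a b ω (2 * j + 1) ≤ t) :
    b ≤ ω.price (truncate (crossingTime a b ω (2 * j + 1)) t) := by
  rcases coe_or_lt t (crossingTime a b ω (2 * j + 1)) with ⟨s, hs, hs'⟩ | h'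
  · rw [hs', truncate_coe, min_eq_left hs]
    simpa [crossingTarget] using price_crossingTime_mem hs'
  · exact absurd h (not_le.2 h')

/-- The first `i` upcrossings of `[a, b]` lose at most `a`, and if all of them are completed before
time `t`, they gain at least `b - a` each. -/
theorem upcrossing_gains (ha : 0 ≤ a) (hab : a ≤ b) (t : TimeInterval T) (ω : PricePath T) (i : ℕ) :
    -a ≤ ∑ j ∈ Finset.range i,
      (ω.price (truncate (crossingTime a b ω (2 * j + 1)) t) -
        ω.price (truncate (crossingTime a b ω (2 * j)) t)) ∧
    ((∀ n < 2 * i, crossingTime a b ω n ≤ t) → i * (b - a) ≤ ∑ j ∈ Finset.range i,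
      (ω.price (truncate (crossingTime a b ω (2 * j + 1)) t) -
        ω.price (truncate (crossingTime a b ω (2 * j)) t))) := by
  induction i with
  | zero => simpa using ha
  | succ i ih =>
    rw [Finset.sum_range_succ]
    by_cases hall : ∀ n < 2 * i, crossingTime a b ω n ≤ t
    · have h1 := ih.2 hall
      have h2 : (0 : ℝ) ≤ i * (b - a) := mul_nonneg i.cast_nonneg (sub_nonneg.2 hab)
      constructor
      · by_cases h3 : crossingTime a b ω (2 * i) ≤ t
        · have h4 := price_truncate_crossingTime_even h3
          have h5 := ω.nonneg (truncate (crossingTime a b ω (2 * i + 1)) t)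
          linarith
        · have h3' := (not_le.1 h3).le
          rw [truncate_of_le h3', truncate_of_le
            (h3'.trans (crossingTime_monotone a b ω (2 * i).le_succ))]
          linarith
      · intro h3
        have h4 := price_truncate_crossingTime_even (h3 (2 * i) (by omega))
        have h5 := price_truncate_crossingTime_odd (h3 (2 * i + 1) (by omega))
        push_cast
        linarith
    · -- once a crossing is later than `t`, the remaining terms vanish
      have hzero : (t : WithTop (TimeInterval T)) ≤ crossingTime a b ω (2 * i) := by
        push Not at hall
        obtain ⟨n, hn, hn'⟩ := hall
        exact hn'.le.trans (crossingTime_monotone a b ω hn.le)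
      rw [truncate_of_le hzero, truncate_of_le
        (hzero.trans (crossingTime_monotone a b ω (2 * i).le_succ)), sub_self, add_zero]
      exact ⟨ih.1, fun h => absurd (fun n hn => h n (by omega)) hall⟩

theorem upcrossingStrategy_nonneg (ha : 0 < a) (hab : a ≤ b) (k : ℕ) (t : TimeInterval T)
    (ω : PricePath T) : 0 ≤ (upcrossingStrategy T a b k).capital t ω := by
  rw [capital_upcrossingStrategy]
  have h := mul_le_mul_of_nonneg_left (upcrossing_gains ha.le hab t ω k).1 (inv_nonneg.2 ha.le)
  rw [mul_neg, inv_mul_cancel₀ ha.ne'] at h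
  linarith

theorem le_capital_upcrossingStrategy (ha : 0 < a) (hab : a ≤ b) {k : ℕ}
    (h : ∀ n < 2 * k, crossingTime a b ω n ≠ ⊤) :
    a⁻¹ * (k * (b - a)) ≤ (upcrossingStrategy T a b k).capital (finalTime T) ω := by
  rw [capital_upcrossingStrategy]
  have h1 := (upcrossing_gains ha.le hab (finalTime T) ω k).2 fun n hn => by
    obtain ⟨s, hs⟩ := WithTop.ne_top_iff_exists.1 (h n hn)
    rw [← hs]
    exact WithTop.coe_le_coe.2 s.2.2
  have h2 := mul_le_mul_of_nonneg_left h1 (inv_nonneg.2 ha.le)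
  linarith

end Upcrossings

/-! ### Paths without a left limit -/

theorem crossingTime_lt_of_frequently {a b : ℝ} {ω : PricePath T} {t : TimeInterval T}
    (h1 : ∃ᶠ s in 𝓝[<] t, ω.price s < a) (h2 : ∃ᶠ s in 𝓝[<] t, b < ω.price s) (n : ℕ) :
    crossingTime a b ω n < t := by
  have key : ∀ n, ∃ᶠ s in 𝓝[<] t, ω.price s ∈ crossingTarget a b n := by
    intro n
    unfold crossingTarget
    split_ifs
    exacts [h1.mono fun _ h => le_of_lt h, h2.mono fun _ h => le_of_lt h]
  have hlt : ∀ᶠ s in 𝓝[<] t, s < t := eventually_mem_nhdsWithin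
  induction n with
  | zero =>
    obtain ⟨s, hs, hst⟩ := ((key 0).and_eventually hlt).exists
    exact (hitFrom_le (isClosed_crossingTarget a b _) (WithTop.coe_le_coe.2 s.2.1) hs).trans_lt
      (WithTop.coe_lt_coe.2 hst)
  | succ n ih =>
    obtain ⟨r, hr⟩ := WithTop.ne_top_iff_exists.1 ih.ne_top
    rw [← hr] at ih
    have hgt : ∀ᶠ s in 𝓝[<] t, r < s :=
      mem_nhdsWithin_of_mem_nhds (Ioi_mem_nhds (WithTop.coe_lt_coe.1 ih))
    obtain ⟨s, hs, hst, hrs⟩ := ((key (n + 1)).and_eventually (hlt.and hgt)).exists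
    refine (hitFrom_le (isClosed_crossingTarget a b _) ?_ hs).trans_lt (WithTop.coe_lt_coe.2 hst)
    rw [← hr]
    exact WithTop.coe_le_coe.2 hrs.le

theorem crossingTime_ne_top_of_two_visits {a b : ℝ} {ω : PricePath T}
    (h0 : ω.price (initialTime T) ≤ a) {s : TimeInterval T} (hs : b ≤ ω.price s) {n : ℕ}
    (hn : n < 2) : crossingTime a b ω n ≠ ⊤ := by
  have h1 : crossingTime a b ω 0 ≤ initialTime T :=
    hitFrom_le (isClosed_crossingTarget a b _) le_rfl (by simpa [crossingTarget] using h0)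
  have h2 : crossingTime a b ω 1 ≤ s :=
    hitFrom_le (isClosed_crossingTarget a b _) (h1.trans (WithTop.coe_le_coe.2 s.2.1))
      (by simpa [crossingTarget] using hs)
  exact ne_top_of_le_ne_top WithTop.coe_ne_top
    ((crossingTime_monotone a b ω (by omega : n ≤ 1)).trans h2)

/-- Oscillation and explosion are the only obstructions to a finite left limit. -/
theorem exists_upcrossings_or_unbounded_of_not_isCadlag {ω : PricePath T} (h : ¬ IsCadlag ω.price) :
    (∃ a b : ℚ, 0 < a ∧ a < b ∧ ∀ n, crossingTime a b ω n ≠ ⊤) ∨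
      ∀ K : ℝ, ∃ s, K ≤ ω.price s := by
  have h1 : ∃ t, ¬ ∃ l, Tendsto ω.price (𝓝[<] t) (𝓝 l) := by
    by_contra! h2
    exact h ⟨ω.rightContinuous, h2⟩
  obtain ⟨t, ht⟩ := h1
  by_contra! hcon
  obtain ⟨hosc, K, hK⟩ := hcon
  refine ht (tendsto_of_no_upcrossings Rat.denseRange_cast ?_
    (isBoundedUnder_of ⟨K, fun s => (hK s).le⟩) (isBoundedUnder_of ⟨0, ω.nonneg⟩))
  rintro _ ⟨a, rfl⟩ _ ⟨b, rfl⟩ hab ⟨h2, h3⟩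
  obtain ⟨s, hs⟩ := h2.exists
  obtain ⟨n, hn⟩ := hosc a b (by exact_mod_cast (ω.nonneg s).trans_lt hs) (by exact_mod_cast hab)
  exact (crossingTime_lt_of_frequently h2 h3 n).ne_top hn

theorem exists_strategy_of_upcrossings {a b : ℝ} (ha : 0 < a) (hab : a < b) (K : ℝ) :
    ∃ G : SimpleStrategy T, G.initialCapital = 1 ∧ (∀ t ω, 0 ≤ G.capital t ω) ∧
      ∀ ω : PricePath T, (∀ n, crossingTime a b ω n ≠ ⊤) → K ≤ G.capital (finalTime T) ω := by
  obtain ⟨k, hk⟩ := exists_nat_ge (K * a / (b - a))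
  refine ⟨upcrossingStrategy T a b k, rfl, upcrossingStrategy_nonneg ha hab.le k, fun ω hω => ?_⟩
  refine le_trans ?_ (le_capital_upcrossingStrategy ha hab.le fun n _ => hω n)
  rw [div_le_iff₀ (sub_pos.2 hab)] at hk
  rwa [← div_eq_inv_mul, le_div_iff₀ ha]

/-- A path that is unbounded and starts below `a` upcrosses `[a, b]` for every `b`, and a single
upcrossing multiplies the capital by `b / a`. -/
theorem exists_strategy_of_unbounded {a : ℝ} (ha : 0 < a) (K : ℝ) :
    ∃ G : SimpleStrategy T, G.initialCapital = 1 ∧ (∀ t ω, 0 ≤ G.capital t ω) ∧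
      ∀ ω : PricePath T, ω.price (initialTime T) ≤ a → (∀ K : ℝ, ∃ s, K ≤ ω.price s) →
        K ≤ G.capital (finalTime T) ω := by
  have hab : a ≤ a + a * |K| := le_add_of_nonneg_right (mul_nonneg ha.le (abs_nonneg K))
  refine ⟨upcrossingStrategy T a (a + a * |K|) 1, rfl, upcrossingStrategy_nonneg ha hab 1,
    fun ω h0 hω => ?_⟩
  obtain ⟨s, hs⟩ := hω (a + a * |K|)
  refine le_trans ?_ (le_capital_upcrossingStrategy ha hab fun n hn =>
    crossingTime_ne_top_of_two_visits h0 hs (by omega))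
  rw [Nat.cast_one, one_mul, add_sub_cancel_left, inv_mul_cancel_left₀ ha.ne']
  exact le_abs_self K

end RightContinuousMarket

open RightContinuousMarket

theorem mainTheorem5 (T : ℝ≥0) :
    RightContinuousMarket.AlmostSurely
      (fun ω : RightContinuousMarket.PricePath T => RightContinuousMarket.IsCadlag ω.price) := by
  let E : {p : ℚ × ℚ // 0 < p.1 ∧ p.1 < p.2} ⊕ ℕ → Set (PricePath T) :=
    Sum.elim (fun p => {ω | ∀ n, crossingTime (p.1.1 : ℝ) p.1.2 ω n ≠ ⊤})
      (fun N => {ω | ω.price (initialTime T) ≤ (N : ℝ) + 1 ∧ ∀ K : ℝ, ∃ s, K ≤ ω.price s})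
  have hE : IsNull (⋃ i, E i) := by
    refine isNull_iUnion fun i K => ?_
    rcases i with ⟨⟨a, b⟩, ha, hab⟩ | N
    · exact exists_strategy_of_upcrossings (by exact_mod_cast ha) (by exact_mod_cast hab) K
    · obtain ⟨G, h1, h2, h3⟩ := exists_strategy_of_unbounded (T := T)
        (show (0 : ℝ) < (N : ℝ) + 1 by positivity) K
      exact ⟨G, h1, h2, fun ω hω => h3 ω hω.1 hω.2⟩
  obtain ⟨S, hS, hS0, hST⟩ := hE
  refine ⟨S, hS, hS0, fun ω hω => hST ω (mem_iUnion.2 ?_)⟩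
  rcases exists_upcrossings_or_unbounded_of_not_isCadlag hω with ⟨a, b, ha, hab, h⟩ | h
  · exact ⟨Sum.inl ⟨(a, b), ha, hab⟩, h⟩
  · obtain ⟨N, hN⟩ := exists_nat_ge (ω.price (initialTime T))
    exact ⟨Sum.inr N, hN.trans (le_add_of_nonneg_right zero_le_one), h⟩
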